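/- Let $\Delta$ be a simplicial complex on a finite vertex set $V$ (every $\{v\}$, $v\in V$, is a face, and so is $\emptyset$), write $\dim F=|F|-1$ for a face $F$, and let $K$ be a field. The facet ideal of $\Delta$ is the ideal $I(\Delta)\subset R=K[x_v : v\in V]$ generated by the monomials $\prod_{v\in F}x_v$, $F$ a facet of $\Delta$. A chain between facets $F$ and $G$ is a sequence of facets $F=F_0,\dots,F_n=G$ with $F_i\cap F_{i+1}\neq\emptyset$ for all $i$; its length is $n$. It is proper if moreover $\dim(F_i\cap F_{i+1})=\dim F_{i+1}-1$ for all $i$. A proper chain between $F$ and $G$ is irredundant if no subsequence of it other than itself is a proper chain between $F$ and $G$. $\Delta$ is connected if any two facets are joined by a chain, and connected in codimension $1$ if any two facets $F,G$ with $\dim F\ge\dim G$ are joined by a proper chain between $F$ and $G$. A facet $F$ of a complex $\Gamma$ is a leaf of $\Gamma$ if it is the only facet of $\Gamma$, or if there is a facet $G\ne F$ of $\Gamma$ with $F\cap H\subseteq F\cap G$ for all facets $H\neq F$ of $\Gamma$. $\Delta$ is a tree if it is connected and every nonempty complex all of whose facets are facets of $\Delta$ has a leaf. A tree $\Delta$ is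 a linear tree (over $K$) if $I(\Delta)$ has a linear resolution, that is, for some $q\ge 0$ its minimal graded free resolution over $R$ has the form $\cdots\to R(-q-1)^{b_1}\to R(-q)^{b_0}\to I(\Delta)\to 0$. For facets $F,G$ of a pure tree that is connected in codimension $1$, $\operatorname{dist}(F,G)$ denotes the length of the (unique) irredundant proper chain between $F$ and $G$. A tree $\Delta$ has the intersection property if it is pure, say of dimension $d$, and connected in codimension $1$, and if for all $k\in\{1,\dots,d+1\}$ and all facets $F,G$ with $\dim(F\cap G)=d-k$ one has $\operatorname{dist}(F,G)=k$. **Theorem.** Let $\Delta$ be a tree. Then $\Delta$ is a linear tree over $K$ if and only if $\Delta$ has the intersection property. -/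

import Mathlib

namespace SimplicialTree

/-! ### Simplicial complexes -/

section Complex

variable {V : Type*}

/-- The faces of a simplicial complex in the convention where the empty set is always a face
(Mathlib's complexes record only the nonempty faces). -/
def IsFace (Δ : PreAbstractSimplicialComplex V) (F : Finset V) : Prop :=
  F = ∅ ∨ F ∈ Δ

/-- A facet is a face that is maximal under inclusion. -/
def IsFacet (Δ : PreAbstractSimplicialComplex V) (F : Finset V) : Prop :=
  Maximal (IsFace Δ) F

/-- The dimension `|F| - 1` of a face; the empty face has dimension `-1`. -/
def faceDim (F : Finset V) : ℤ :=
  (F.card : ℤ) - 1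

/-- `Δ` is pure of dimension `d`: all its facets have dimension `d`. (A complex on a finite vertex
set has a facet, so `d` is determined by `Δ` and equals `dim Δ`.) -/
def IsPureOfDim (Δ : PreAbstractSimplicialComplex V) (d : ℤ) : Prop :=
  ∀ F, IsFacet Δ F → faceDim F = d

/-- `Γ` is a subcomplex of `Δ` in the sense that every facet of `Γ` is a facet of `Δ`. -/
def IsFacetSubcomplex (Γ Δ : PreAbstractSimplicialComplex V) : Prop :=
  ∀ F, IsFacet Γ F → IsFacet Δ F

variable [DecidableEq V]

/-- A chain of facets of `Δ` between `F` and `G`: a sequence `F = F₀, …, Fₙ = G` of facets in which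
consecutive members meet. Its length `n` is one less than the length of the list. -/
def IsFacetChain (Δ : PreAbstractSimplicialComplex V) (F G : Finset V)
    (C : List (Finset V)) : Prop :=
  (∀ H ∈ C, IsFacet Δ H) ∧ C.head? = some F ∧ C.getLast? = some G ∧
    C.IsChain (fun A B => (A ∩ B).Nonempty)

/-- A proper chain: a chain with `dim (Fᵢ ∩ Fᵢ₊₁) = dim Fᵢ₊₁ - 1` throughout. -/
def IsProperChain (Δ : PreAbstractSimplicialComplex V) (F G : Finset V)
    (C : List (Finset V)) : Prop :=
  IsFacetChain Δ F G C ∧ C.IsChain (fun A B => faceDim (A ∩ B) = faceDim B - 1)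

/-- An irredundant proper chain between `F` and `G`: no subsequence other than the chain itself is
a proper chain between `F` and `G`. -/
def IsIrredundantProperChain (Δ : PreAbstractSimplicialComplex V) (F G : Finset V)
    (C : List (Finset V)) : Prop :=
  IsProperChain Δ F G C ∧ ∀ C' : List (Finset V), C'.Sublist C → IsProperChain Δ F G C' → C' = C

/-- `Δ` is connected: any two facets are joined by a chain. -/
def IsConnectedComplex (Δ : PreAbstractSimplicialComplex V) : Prop :=
  ∀ F G, IsFacet Δ F → IsFacet Δ G → ∃ C, IsFacetChain Δ F G C

/-- `Δ` is connected in codimension one: any two facets `F`, `G` with `dim F ≥ dim G` are joined by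
a proper chain. -/
def IsConnectedInCodimOne (Δ : PreAbstractSimplicialComplex V) : Prop :=
  ∀ F G, IsFacet Δ F → IsFacet Δ G → faceDim G ≤ faceDim F → ∃ C, IsProperChain Δ F G C

/-- A leaf of `Δ`: a facet `F` that is the only facet, or for which some other facet `G` satisfies
`F ∩ H ⊆ F ∩ G` for all facets `H ≠ F`. -/
def IsLeaf (Δ : PreAbstractSimplicialComplex V) (F : Finset V) : Prop :=
  IsFacet Δ F ∧
    ((∀ H, IsFacet Δ H → H = F) ∨
      ∃ G, IsFacet Δ G ∧ G ≠ F ∧ ∀ H, IsFacet Δ H → H ≠ F → F ∩ H ⊆ F ∩ G)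

/-- A (simplicial) tree: a connected complex all of whose nonempty subcomplexes have a leaf. (On a
finite vertex set every complex has a facet, if only the empty one, so that every `Γ` below is
nonempty; a `Γ` whose only face is `∅` counts only if `∅` is itself a facet of `Δ`.) -/
def IsTree (Δ : PreAbstractSimplicialComplex V) : Prop :=
  IsConnectedComplex Δ ∧ ∀ Γ, IsFacetSubcomplex Γ Δ → ∃ F, IsLeaf Γ F

/-- The distance between two facets: the length of the irredundant proper chain between them. In a
pure tree connected in codimension one, where the notion is used, there is exactly one such chain,
so that the infimum is taken over a one-element set. -/
noncomputable def facetDist (Δ : PreAbstractSimplicialComplex V) (F G : Finset V) : ℕ :=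
  sInf {n : ℕ | ∃ C, IsIrredundantProperChain Δ F G C ∧ C.length = n + 1}

/-- The intersection property: `Δ` is pure of some dimension `d`, connected in codimension one, and
`dim (F ∩ G) = d - k` with `1 ≤ k ≤ d + 1` implies `dist (F, G) = k`, for all facets `F`, `G`. -/
def HasIntersectionProperty (Δ : PreAbstractSimplicialComplex V) : Prop :=
  ∃ d : ℤ, IsPureOfDim Δ d ∧ IsConnectedInCodimOne Δ ∧
    ∀ F G, IsFacet Δ F → IsFacet Δ G → ∀ k : ℕ, 1 ≤ k → (k : ℤ) ≤ d + 1 →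
      faceDim (F ∩ G) = d - k → facetDist Δ F G = k

end Complex

/-! ### Facet ideals and linear resolutions -/

section Algebra

open MvPolynomial

variable {V : Type*} (K : Type*) [Field K]

/-- The facet ideal of `Δ`, generated by the squarefree monomials `∏ v ∈ F, x_v`, `F` a facet. -/
noncomputable def facetIdeal (Δ : PreAbstractSimplicialComplex V) : Ideal (MvPolynomial V K) :=
  Ideal.span {f | ∃ F, IsFacet Δ F ∧ f = ∏ v ∈ F, X v}

variable {K}

/-- The ideal `I` of `R = K[x_v]` has a (`q`-)linear resolution for some `q`: an exact sequence
`⋯ → R(-q-2)^(b 2) → R(-q-1)^(b 1) → R(-q)^(b 0) → I → 0` of graded modules and maps of degree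
zero. In terms of the standard bases this says that the generators of `I` given by the augmentation
`ε` are forms of degree `q` and that the matrices of all the maps `δ i` consist of linear forms
(possibly zero). Such a resolution is automatically the minimal graded free resolution. -/
def HasLinearResolution (I : Ideal (MvPolynomial V K)) : Prop :=
  ∃ (q : ℕ) (b : ℕ → ℕ)
    (ε : (Fin (b 0) → MvPolynomial V K) →ₗ[MvPolynomial V K] MvPolynomial V K)
    (δ : ∀ i : ℕ, (Fin (b (i + 1)) → MvPolynomial V K) →ₗ[MvPolynomial V K]
      (Fin (b i) → MvPolynomial V K)),
    LinearMap.range ε = I ∧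
    Function.Exact (δ 0) ε ∧
    (∀ i, Function.Exact (δ (i + 1)) (δ i)) ∧
    (∀ j, (ε (Pi.single j 1)).IsHomogeneous q) ∧
    (∀ i j l, (δ i (Pi.single j 1) l).IsHomogeneous 1)

end Algebra

/-- A linear tree (over the field `K`): a tree whose facet ideal has a linear resolution. -/
def IsLinearTree {V : Type*} [DecidableEq V] (K : Type*) [Field K]
    (Δ : PreAbstractSimplicialComplex V) : Prop :=
  IsTree Δ ∧ HasLinearResolution (facetIdeal K Δ)

end SimplicialTree

/-! Both sides are equivalent to a condition on the facets alone: they have a common size, and for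
facets A ≠ B some facet C ⊆ A ∪ B has |C \ A| = 1 (`HasExchange`).

A linear resolution forces exchange (`exchange_of_hasLinearResolution`): the relation between x^F
and x^G with coefficients x^(G \ F) and x^(F \ G) must come from linear syzygies, but if F has no
neighbour inside F ∪ G, no linear syzygy involves a vertex of G \ F in its coefficient at F.
Conversely, removing a leaf preserves exchange (`HasExchange.erase_leaf`), so the facets in reverse
order of removal have linear quotients; these pass to the syzygy module
(`HasLinearQuotients.exists_syzygies`), and iteration builds the resolution.

As each step of a proper chain brings in one new vertex, a chain from F to G has at least |G \ F|
steps, and the intersection property says that distances attain this bound. The first step of a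
chain attaining it is an exchange; conversely, leaves and exchange yield such chains
(`exists_gallery`). -/

namespace SimplicialTree

/-! ### Linear quotients and linear resolutions -/

section LinearQuotients

open MvPolynomial

variable {V K : Type*} [Field K]

lemma homogeneousComponent_mul_of_isHomogeneous (a q : ℕ) (p f : MvPolynomial V K)
    (hf : f.IsHomogeneous q) :
    homogeneousComponent (a + q) (p * f) = homogeneousComponent a p * f := by
  classical
  ext d
  rw [coeff_homogeneousComponent, coeff_mul, coeff_mul]
  simp only [coeff_homogeneousComponent]
  have key : ∀ x ∈ Finset.HasAntidiagonal.antidiagonal d, coeff x.2 f ≠ 0 →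
      d.degree = x.1.degree + q := by
    intro x hx h
    have h2 : x.2.degree = q := by
      by_contra hne
      exact h (hf.coeff_eq_zero hne)
    rw [← Finset.HasAntidiagonal.mem_antidiagonal.1 hx, map_add, h2]
  split_ifs with hd
  · refine Finset.sum_congr rfl fun x hx => ?_
    by_cases h : coeff x.2 f = 0
    · simp [h]
    · rw [if_pos (by have := key x hx h; omega)]
  · refine (Finset.sum_eq_zero fun x hx => ?_).symm
    by_cases h : coeff x.2 f = 0
    · simp [h]
    · rw [if_neg (by have := key x hx h; omega), zero_mul]

/-- A finite linearly ordered family in a module over `K[x_v]` has linear quotients if each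
successive colon ideal is generated by variables, each relation witnessing this having linear
coefficients. -/
def HasLinearQuotients {ι M : Type*} [Fintype ι] [LinearOrder ι] [AddCommGroup M]
    [Module (MvPolynomial V K) M] (g : ι → M) : Prop :=
  ∀ i, ∃ (k : ℕ) (a : Fin k → V), Function.Injective a ∧
    (∀ t, ∃ l : ι → MvPolynomial V K, (∀ j, (l j).IsHomogeneous 1) ∧ (∀ j, i ≤ j → l j = 0) ∧
      (X (a t) : MvPolynomial V K) • g i = ∑ j, l j • g j) ∧
    ∀ (r : MvPolynomial V K) (c : ι → MvPolynomial V K), (∀ j, i ≤ j → c j = 0) →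
      r • g i = ∑ j, c j • g j → r ∈ Ideal.span (X '' Set.range a)

lemma HasLinearQuotients.reindex {ι ι' M : Type*} [Fintype ι] [LinearOrder ι] [Fintype ι']
    [LinearOrder ι'] [AddCommGroup M] [Module (MvPolynomial V K) M] {g : ι → M}
    (hg : HasLinearQuotients (V := V) (K := K) g) (e : ι' ≃o ι) :
    HasLinearQuotients (V := V) (K := K) (g ∘ e) := by
  intro i
  obtain ⟨k, a, ha, h1, h2⟩ := hg (e i)
  refine ⟨k, a, ha, fun t => ?_, fun r c hc hr => ?_⟩
  · obtain ⟨l, hl, hl0, hl1⟩ := h1 t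
    refine ⟨l ∘ e, fun j => hl _, fun j hj => hl0 _ (e.monotone hj), ?_⟩
    rw [Function.comp_apply, hl1]
    exact (Equiv.sum_comp e.toEquiv (fun j => l j • g j)).symm
  · refine h2 r (c ∘ e.symm) (fun j hj => hc _ ((OrderIso.le_symm_apply e).2 hj)) ?_
    rw [← Equiv.sum_comp e.toEquiv]
    simpa using hr

/-- In degree q + 1 only the linear part of each coefficient contributes. This supplies the linear
coefficients that linear quotients demand. -/
lemma eq_sum_homogeneousComponent {ι κ : Type*} [Fintype κ] (q : ℕ)
    (s : κ → ι → MvPolynomial V K) (hs : ∀ p j, (s p j).IsHomogeneous q)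
    (z : ι → MvPolynomial V K) (hz : ∀ j, (z j).IsHomogeneous (q + 1))
    (d : κ → MvPolynomial V K) (h : z = ∑ p, d p • s p) :
    z = ∑ p, homogeneousComponent 1 (d p) • s p := by
  funext j
  have h1 := congrArg (homogeneousComponent (1 + q)) (congrFun h j)
  rw [add_comm 1 q, homogeneousComponent_eq_self (hz j)] at h1
  rw [h1]
  simp only [Finset.sum_apply, Pi.smul_apply, smul_eq_mul, map_sum]
  refine Finset.sum_congr rfl fun p _ => ?_
  rw [add_comm q 1, homogeneousComponent_mul_of_isHomogeneous 1 q _ _ (hs p j)]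

lemma mem_span_X_of_mul_X_mem {s : Set V} {v : V} (hv : v ∉ s) {r : MvPolynomial V K}
    (h : r * X v ∈ Ideal.span (X '' s : Set (MvPolynomial V K))) :
    r ∈ Ideal.span (X '' s : Set (MvPolynomial V K)) := by
  classical
  rw [mem_ideal_span_X_image] at h ⊢
  intro m hm
  obtain ⟨i, hi, hmi⟩ := h (m + Finsupp.single v 1) (by
    rw [mem_support_iff, coeff_mul_X]
    exact mem_support_iff.1 hm)
  refine ⟨i, hi, ?_⟩
  have : v ≠ i := fun h => hv (h ▸ hi)
  simpa [Finsupp.single_apply, this] using hmi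

/-- The first syzygy module of a family with linear quotients is generated by a family of vectors
of linear forms that has linear quotients again. -/
lemma HasLinearQuotients.exists_syzygies {m : ℕ} {M : Type*} [AddCommGroup M]
    [Module (MvPolynomial V K) M] {g : Fin m → M}
    (hg : HasLinearQuotients (V := V) (K := K) g) :
    ∃ (n : ℕ) (s : Fin n → Fin m → MvPolynomial V K),
      HasLinearQuotients (V := V) (K := K) s ∧ (∀ p j, (s p j).IsHomogeneous 1) ∧
      Function.Exact (Fintype.linearCombination (MvPolynomial V K) s)
        (Fintype.linearCombination (MvPolynomial V K) g) := by
  classical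
  choose k a ha l hcolon using hg
  choose l hl hl0 hl1 using l
  -- One syzygy x_{a(i,t)} e_i - l(i,t) for each generator of each colon ideal. The order is
  -- lexicographic, and coordinates beyond i vanish.
  let κ := Σₗ i : Fin m, Fin (k i)
  have : Fintype κ := Fintype.ofEquiv (Σ i : Fin m, Fin (k i)) toLex
  let s : κ → Fin m → MvPolynomial V K := fun p =>
    Pi.single (ofLex p).1 (X (a _ (ofLex p).2)) - l _ (ofLex p).2
  have hsval : ∀ (i : Fin m) (t : Fin (k i)),
    s (toLex ⟨i, t⟩) = Pi.single i (X (a i t)) - l i t := fun _ _ => rfl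
  have hsX : ∀ (i : Fin m) (t : Fin (k i)), s (toLex ⟨i, t⟩) i = X (a i t) := by
    intro i t
    simp [hsval, hl0 i t i le_rfl]
  have hs0 : ∀ (i : Fin m) (t : Fin (k i)) (j : Fin m), i < j → s (toLex ⟨i, t⟩) j = 0 := by
    intro i t j hij
    simp [hsval, hl0 i t j hij.le, Pi.single_eq_of_ne hij.ne']
  have hshom : ∀ p j, (s p j).IsHomogeneous 1 := by
    intro p j
    obtain ⟨⟨i, t⟩, rfl⟩ := toLex.surjective p
    rw [hsval, Pi.sub_apply]
    refine IsHomogeneous.sub ?_ (hl i t j)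
    by_cases h : j = i
    · subst h
      simpa using isHomogeneous_X K (a j t)
    · rw [Pi.single_eq_of_ne h]
      exact isHomogeneous_zero _ _ _
  have hsker : ∀ p, ∑ j, s p j • g j = 0 := by
    intro p
    obtain ⟨⟨i, t⟩, rfl⟩ := toLex.surjective p
    simp only [hsval, Pi.sub_apply, sub_smul, Finset.sum_sub_distrib]
    rw [← hl1 i t, sub_eq_zero, Finset.sum_eq_single i]
    · simp
    · intro j _ hj
      simp [Pi.single_eq_of_ne hj]
    · simp
  -- Division by leading coordinates. The bound on the support of `d` is what later places relations
  -- among strictly earlier syzygies.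
  have hspan : ∀ (n : ℕ) (c : Fin m → MvPolynomial V K), (∀ j : Fin m, n ≤ j.val → c j = 0) →
      ∑ j, c j • g j = 0 → ∃ d : κ → MvPolynomial V K,
        (∀ p, n ≤ (ofLex p).1.val → d p = 0) ∧ c = ∑ p, d p • s p := by
    intro n
    induction n with
    | zero =>
      intro c hc _
      refine ⟨0, fun _ _ => rfl, ?_⟩
      funext j
      simp [hc j (Nat.zero_le _)]
    | succ n ih =>
      intro c hc hcg
      by_cases hn : n < m
      · let i : Fin m := ⟨n, hn⟩
        have hci : c i ∈ Ideal.span (X '' Set.range (a i)) := by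
          refine hcolon i (c i) (fun j => if j < i then - c j else 0) (fun j hj => ?_) ?_
          · simp [not_lt.2 hj]
          · have : ∀ j, c j • g j = (if j = i then c i • g i else 0) -
                (if j < i then - c j else 0) • g j := by
              intro j
              rcases lt_trichotomy j i with h | h | h
              · rw [if_neg h.ne, if_pos h, neg_smul, sub_neg_eq_add, zero_add]
              · simp [h]
              · simp [h.ne', not_lt.2 h.le, hc j h]
            rw [Finset.sum_congr rfl fun j _ => this j, Finset.sum_sub_distrib] at hcg
            simpa [sub_eq_zero] using hcg
        rw [← Set.range_comp, Ideal.mem_span_range_iff_exists_fun] at hci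
        obtain ⟨r, hr⟩ := hci
        -- The coordinate `c i` lies in the i-th colon ideal, so subtracting multiples of the
        -- syzygies of block i cancels it.
        obtain ⟨d, hd0, hd⟩ := ih (c - ∑ t, r t • s (toLex ⟨i, t⟩)) (by
          intro j hj
          rcases hj.eq_or_lt with h | h
          · have : j = i := Fin.ext h.symm
            subst this
            simp only [Pi.sub_apply, Finset.sum_apply, Pi.smul_apply, hsX, smul_eq_mul]
            rw [← hr]
            simp
          · simp only [Pi.sub_apply, Finset.sum_apply, Pi.smul_apply]
            rw [hc j h, Finset.sum_eq_zero, sub_zero]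
            intro t _
            rw [hs0 i t j h, smul_zero]) (by
          simp only [Pi.sub_apply, sub_smul, Finset.sum_sub_distrib, hcg, Finset.sum_apply,
            Pi.smul_apply, Finset.sum_smul, smul_assoc]
          rw [Finset.sum_comm]
          simp [← Finset.smul_sum, hsker])
        let d' : κ → MvPolynomial V K := fun p =>
          if h : (ofLex p).1 = i then r (h ▸ (ofLex p).2) else 0
        have hd' : ∑ p, d' p • s p = ∑ t, r t • s (toLex ⟨i, t⟩) := by
          have : ∑ p, d' p • s p =
              ∑ p : (Σ i : Fin m, Fin (k i)), d' (toLex p) • s (toLex p) :=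
            (Equiv.sum_comp toLex (fun p => d' p • s p)).symm
          rw [this, Fintype.sum_sigma, Finset.sum_eq_single i]
          · simp [d']
          · intro j _ hj
            refine Finset.sum_eq_zero fun t _ => ?_
            simp [d', hj]
          · simp
        refine ⟨d + d', fun p hp => ?_, ?_⟩
        · have hne : (ofLex p).1 ≠ i := by
            intro h
            rw [h] at hp
            exact absurd hp (by simp [i])
          simp [d', hne, hd0 p (by omega)]
        · simp only [Pi.add_apply, add_smul, Finset.sum_add_distrib]
          rw [hd', ← hd, sub_add_cancel]
      · obtain ⟨d, hd0, hd⟩ := ih c (fun j hj => absurd j.isLt (by omega)) hcg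
        exact ⟨d, fun p hp => hd0 p (by omega), hd⟩
  -- The colon ideal at (i, t) is generated by the variables a(i, u) with u < t.
  have hLQ : HasLinearQuotients (V := V) (K := K) s := by
    intro p
    obtain ⟨⟨i, t⟩, rfl⟩ := toLex.surjective p
    have hlt : ∀ u : Fin t.val, Fin.castLE t.isLt.le u < t := fun u => u.isLt
    refine ⟨t.val, a i ∘ Fin.castLE t.isLt.le,
      (ha i).comp (Fin.castLE_injective _), fun u => ?_, fun r c hc hr => ?_⟩
    · set u' : Fin (k i) := Fin.castLE t.isLt.le u with hu'
      -- Coordinate i cancels in this combination, so it is a syzygy generated by the blocks before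
      -- i.
      have hz : ∀ j, ((X (a i u') : MvPolynomial V K) • s (toLex ⟨i, t⟩) -
          (X (a i t) : MvPolynomial V K) • s (toLex ⟨i, u'⟩)) j = 0 ∨ j < i := by
        intro j
        rcases lt_trichotomy j i with h | h | h
        · exact Or.inr h
        · subst h
          left
          simp only [Pi.sub_apply, Pi.smul_apply, hsX, smul_eq_mul]
          ring
        · left
          simp [hs0 i _ j h]
      obtain ⟨d, hd0, hd⟩ := hspan i.val ((X (a i u') : MvPolynomial V K) • s (toLex ⟨i, t⟩) -
          (X (a i t) : MvPolynomial V K) • s (toLex ⟨i, u'⟩))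
        (fun j hj => (hz j).resolve_right (not_lt.2 hj)) (by
          simp only [Pi.sub_apply, Pi.smul_apply, sub_smul, Finset.sum_sub_distrib, smul_assoc]
          rw [← Finset.smul_sum, ← Finset.smul_sum, hsker, hsker]
          simp)
      have hd1 := eq_sum_homogeneousComponent 1 s hshom _ (fun j => by
        rw [Pi.sub_apply, Pi.smul_apply, Pi.smul_apply, smul_eq_mul, smul_eq_mul]
        exact ((isHomogeneous_X K _).mul (hshom _ _)).sub
          ((isHomogeneous_X K _).mul (hshom _ _))) d hd
      refine ⟨fun p => homogeneousComponent 1 (d p) +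
        (Pi.single (toLex ⟨i, u'⟩) (X (a i t)) : κ → MvPolynomial V K) p, fun p => ?_,
        fun p hp => ?_, ?_⟩
      · refine (homogeneousComponent_isHomogeneous _ _).add ?_
        by_cases h : p = toLex ⟨i, u'⟩
        · subst h
          simpa using isHomogeneous_X K _
        · rw [Pi.single_eq_of_ne h]
          exact isHomogeneous_zero _ _ _
      · dsimp only
        have h1 : p ≠ toLex ⟨i, u'⟩ := by
          rintro rfl
          exact absurd hp (not_le.2 (Sigma.Lex.right _ _ (hlt u)))
        have h2 : i ≤ (ofLex p).1 := by
          rcases Sigma.Lex.le_def.1 hp with h | ⟨h, _⟩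
          · exact le_of_lt h
          · exact le_of_eq h
        rw [Pi.single_eq_of_ne h1, hd0 p h2]
        simp
      · simp only [add_smul, Finset.sum_add_distrib]
        rw [← hd1, Finset.sum_eq_single (toLex ⟨i, u'⟩)]
        · simp [hu']
        · intro p _ hp
          rw [Pi.single_eq_of_ne hp, zero_smul]
        · simp
    -- Coordinate i of the relation puts r · x_{a(i,t)} in the ideal of the x_{a(i,u)}, u < t; as
    -- a(i,t) is none of these variables, it can be cancelled.
    · refine mem_span_X_of_mul_X_mem (v := a i t) ?_ ?_
      · rintro ⟨u, hu⟩
        exact (hlt u).ne (ha i hu)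
      · have := congrFun hr i
        rw [Pi.smul_apply, hsX, smul_eq_mul] at this
        rw [this, Finset.sum_apply]
        refine Ideal.sum_mem _ fun p _ => ?_
        rw [Pi.smul_apply, smul_eq_mul]
        obtain ⟨⟨j, u⟩, rfl⟩ := toLex.surjective p
        rcases lt_trichotomy j i with h | h | h
        · rw [hs0 j u i h, mul_zero]
          exact Ideal.zero_mem _
        · subst h
          rcases lt_or_ge u t with hu | hu
          · rw [hsX]
            exact Ideal.mul_mem_left _ _ (Ideal.subset_span ⟨_, ⟨⟨u.val, hu⟩, rfl⟩, rfl⟩)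
          · rw [hc (toLex ⟨j, u⟩) (Sigma.Lex.right _ _ hu), zero_mul]
            exact Ideal.zero_mem _
        · rw [hc (toLex ⟨j, u⟩) (Sigma.Lex.left _ _ h), zero_mul]
          exact Ideal.zero_mem _
  let e : Fin (Fintype.card κ) ≃o κ := Fintype.orderIsoFinOfCardEq κ rfl
  refine ⟨_, s ∘ e, hLQ.reindex e, fun p j => hshom _ _, fun c => ⟨fun hc => ?_, ?_⟩⟩
  · obtain ⟨d, -, hd⟩ := hspan m c (fun j hj => absurd j.isLt (by omega)) hc
    refine ⟨d ∘ e, ?_⟩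
    rw [hd, Fintype.linearCombination_apply]
    exact Equiv.sum_comp e.toEquiv (fun p => d p • s p)
  · rintro ⟨d, rfl⟩
    simp only [Fintype.linearCombination_apply, Finset.sum_apply, Pi.smul_apply,
      Finset.sum_smul, smul_assoc, Function.comp_apply]
    rw [Finset.sum_comm]
    simp [← Finset.smul_sum, hsker]

/-- An ideal generated by a sequence of forms of degree `q` with linear quotients has a linear
resolution. -/
theorem HasLinearQuotients.hasLinearResolution {m q : ℕ} {g : Fin m → MvPolynomial V K}
    (hg : HasLinearQuotients (V := V) (K := K) g) (hq : ∀ i, (g i).IsHomogeneous q) :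
    HasLinearResolution (Ideal.span (Set.range g)) := by
  obtain ⟨n₀, s₀, hs₀, hlin₀, hex₀⟩ := hg.exists_syzygies
  -- A node is a free module of rank b with a family of linear vectors in it having linear
  -- quotients; the next node lives in the free module on that family.
  let Node := Σ b : ℕ, {N : Σ n : ℕ, (Fin n → Fin b → MvPolynomial V K) //
    HasLinearQuotients (V := V) (K := K) N.2 ∧ ∀ p j, (N.2 p j).IsHomogeneous 1}
  have hstep : ∀ x : Node, ∃ y : {N : Σ n : ℕ, (Fin n → Fin x.2.1.1 → MvPolynomial V K) //
      HasLinearQuotients (V := V) (K := K) N.2 ∧ ∀ p j, (N.2 p j).IsHomogeneous 1},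
      Function.Exact (Fintype.linearCombination (MvPolynomial V K) y.1.2)
        (Fintype.linearCombination (MvPolynomial V K) x.2.1.2) := by
    rintro ⟨b, ⟨⟨n, s⟩, hs, hl⟩⟩
    obtain ⟨n', s', hs', hl', hex⟩ := hs.exists_syzygies
    exact ⟨⟨⟨n', s'⟩, hs', hl'⟩, hex⟩
  choose next hnext using hstep
  let seq : ℕ → Node := fun i =>
    Nat.rec (⟨m, ⟨⟨n₀, s₀⟩, hs₀, hlin₀⟩⟩ : Node) (fun _ x => ⟨x.2.1.1, next x⟩) i
  refine ⟨q, fun i => (seq i).1, Fintype.linearCombination (MvPolynomial V K) g,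
    fun i => Fintype.linearCombination (MvPolynomial V K) (seq i).2.1.2,
    Fintype.range_linearCombination _ _, hex₀, fun i => hnext (seq i), fun j => ?_,
    fun i j l => ?_⟩
  · have := Fintype.linearCombination_apply_single (MvPolynomial V K) (v := g) j 1
    rw [this, one_smul]
    exact hq j
  · have := Fintype.linearCombination_apply_single (MvPolynomial V K) (v := (seq i).2.1.2) j 1
    rw [this, one_smul]
    exact (seq i).2.2.2 j l

end LinearQuotients

/-! ### Uniform set families with leaves and exchange -/

section FacetFamilies

variable {V : Type*} [DecidableEq V]

/-- Every nonempty subfamily of the family `S` has a leaf. -/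
def HasLeaves (S : Finset (Finset V)) : Prop :=
  ∀ T ⊆ S, T.Nonempty → ∃ A ∈ T, (∀ H ∈ T, H = A) ∨
    ∃ B ∈ T, B ≠ A ∧ ∀ H ∈ T, H ≠ A → A ∩ H ⊆ A ∩ B

/-- From any member of `S` one can move towards any other one by exchanging a single vertex. -/
def HasExchange (S : Finset (Finset V)) : Prop :=
  ∀ A ∈ S, ∀ B ∈ S, A ≠ B → ∃ C ∈ S, C ⊆ A ∪ B ∧ (C \ A).card = 1

lemma HasLeaves.mono {S T : Finset (Finset V)} (hS : HasLeaves S) (h : T ⊆ S) : HasLeaves T :=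
  fun U hU hne => hS U (hU.trans h) hne

/-- The set C exchanged between X and Y is never the leaf: being covered by X and Y, a leaf would
lie inside its joint B and equal it by uniformity. -/
lemma HasExchange.erase_leaf {S : Finset (Finset V)} {q : ℕ} (hq : ∀ A ∈ S, A.card = q)
    (hS : HasExchange S) {A : Finset V} (hA : A ∈ S)
    (hleaf : (∀ H ∈ S, H = A) ∨ ∃ B ∈ S, B ≠ A ∧ ∀ H ∈ S, H ≠ A → A ∩ H ⊆ A ∩ B) :
    HasExchange (S.erase A) := by
  intro X hX Y hY hXY
  rw [Finset.mem_erase] at hX hY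
  obtain ⟨C, hC, hsub, hcard⟩ := hS X hX.2 Y hY.2 hXY
  refine ⟨C, Finset.mem_erase.2 ⟨?_, hC⟩, hsub, hcard⟩
  rintro rfl
  rcases hleaf with h | ⟨B, hB, hBC, h⟩
  · exact hX.1 (h X hX.2)
  · have h1 := h X hX.2 hX.1
    have h2 := h Y hY.2 hY.1
    have : C ⊆ B := by
      intro v hv
      rcases Finset.mem_union.1 (hsub hv) with hv' | hv'
      · exact (Finset.mem_inter.1 (h1 (Finset.mem_inter.2 ⟨hv, hv'⟩))).2
      · exact (Finset.mem_inter.1 (h2 (Finset.mem_inter.2 ⟨hv, hv'⟩))).2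
    exact hBC (Finset.eq_of_subset_of_card_le this (by rw [hq _ hB, hq _ hC])).symm

/-- A leaf of a family with exchange meets its joint in codimension one. -/
lemma HasExchange.card_joint_sdiff {S : Finset (Finset V)} {q : ℕ} (hq : ∀ A ∈ S, A.card = q)
    (hS : HasExchange S) {A B : Finset V} (hA : A ∈ S) (hB : B ∈ S) (hBA : B ≠ A)
    (h : ∀ H ∈ S, H ≠ A → A ∩ H ⊆ A ∩ B) : (B \ A).card = 1 := by
  obtain ⟨C, hC, -, hcard⟩ := hS A hA B hB hBA.symm
  have hCA : C ≠ A := by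
    rintro rfl
    simp at hcard
  -- A ∩ C has q - 1 elements and lies in A ∩ B, so B misses at most one vertex of A.
  have h1 := Finset.card_le_card (h C hC hCA)
  have h2 := Finset.card_sdiff_add_card_inter C A
  have h3 := Finset.card_sdiff_add_card_inter B A
  rw [Finset.inter_comm] at h2 h3
  rw [hq _ hC] at h2
  rw [hq _ hB] at h3
  have h4 : (B \ A).card ≠ 0 := by
    intro h0
    rw [Finset.card_eq_zero, Finset.sdiff_eq_empty_iff_subset] at h0
    exact hBA (Finset.eq_of_subset_of_card_le h0 (by rw [hq _ hB, hq _ hA]))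
  omega

/-- Leaves are removed until F or G is the leaf; its joint B then contains F ∩ G. Which end comes
first is not controlled, hence the disjunction. -/
lemma HasLeaves.exists_step_of_hasExchange {q : ℕ} (n : ℕ) : ∀ {S : Finset (Finset V)},
    S.card = n → HasLeaves S → (∀ A ∈ S, A.card = q) → HasExchange S →
    ∀ {F G : Finset V}, F ∈ S → G ∈ S → F ≠ G →
    ∃ B ∈ S, F ∩ G ⊆ B ∧ ((B \ F).card = 1 ∨ (B \ G).card = 1) := by
  induction n with
  | zero =>
    intro S hn _ _ _ F _ hF
    rw [Finset.card_eq_zero] at hn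
    simp [hn] at hF
  | succ n ih =>
    intro S hn hL hq hE F G hF hG hFG
    obtain ⟨A, hA, hleaf⟩ := hL S subset_rfl ⟨F, hF⟩
    by_cases hAF : A = F
    · subst hAF
      rcases hleaf with h | ⟨B, hB, hBA, h⟩
      · exact absurd (h G hG).symm hFG
      · exact ⟨B, hB, (h G hG hFG.symm).trans Finset.inter_subset_right,
          Or.inl (hE.card_joint_sdiff hq hA hB hBA h)⟩
    by_cases hAG : A = G
    · subst hAG
      rcases hleaf with h | ⟨B, hB, hBA, h⟩
      · exact absurd (h F hF) hFG
      · refine ⟨B, hB, ?_, Or.inr (hE.card_joint_sdiff hq hA hB hBA h)⟩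
        rw [Finset.inter_comm]
        exact (h F hF hFG).trans Finset.inter_subset_right
    · obtain ⟨B, hB, h⟩ := ih (S := S.erase A) (by rw [Finset.card_erase_of_mem hA, hn]; rfl)
        (hL.mono (Finset.erase_subset _ _)) (fun X hX => hq X (Finset.mem_of_mem_erase hX))
        (hE.erase_leaf hq hA hleaf) (Finset.mem_erase.2 ⟨Ne.symm hAF, hF⟩)
        (Finset.mem_erase.2 ⟨Ne.symm hAG, hG⟩) hFG
      exact ⟨B, Finset.mem_of_mem_erase hB, h⟩

lemma card_sdiff_lt_of_step {F G B : Finset V} (hcard : B.card = F.card) (hBF : B ≠ F)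
    (h1 : F ∩ G ⊆ B) (h2 : B ⊆ F ∪ G) : (B \ G).card < (F \ G).card := by
  refine Finset.card_lt_card ⟨fun v hv => ?_, fun h => ?_⟩
  · have := h2 (Finset.sdiff_subset hv)
    simp only [Finset.mem_sdiff, Finset.mem_union] at hv this ⊢
    tauto
  · refine hBF (Finset.eq_of_subset_of_card_le (fun v hv => ?_) hcard.le).symm
    by_cases hvG : v ∈ G
    · exact h1 (Finset.mem_inter.2 ⟨hv, hvG⟩)
    · exact Finset.sdiff_subset (h (Finset.mem_sdiff.2 ⟨hv, hvG⟩))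

lemma card_sdiff_comm_of_card_eq {A B : Finset V} (h : A.card = B.card) :
    (A \ B).card = (B \ A).card := by
  have h1 := Finset.card_sdiff_add_card_inter A B
  have h2 := Finset.card_sdiff_add_card_inter B A
  rw [Finset.inter_comm] at h2
  omega

/-- In a uniform family with leaves and exchange, any two members `F` and `G` are joined by a
gallery of at most `|F \ G|` steps. -/
lemma exists_gallery {S : Finset (Finset V)} {q : ℕ} (hL : HasLeaves S)
    (hq : ∀ A ∈ S, A.card = q) (hE : HasExchange S) (n : ℕ) : ∀ {F G : Finset V},
    F ∈ S → G ∈ S → (F \ G).card = n → ∃ C : List (Finset V), (∀ H ∈ C, H ∈ S) ∧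
      C.head? = some F ∧ C.getLast? = some G ∧ C.IsChain (fun A B => (B \ A).card = 1) ∧
      C.length ≤ n + 1 := by
  induction n using Nat.strong_induction_on with
  | _ n ih =>
    intro F G hF hG hn
    by_cases hFG : F = G
    · subst hFG
      exact ⟨[F], by simpa using hF, rfl, rfl, List.isChain_singleton _, by simp⟩
    -- Restriction to members inside F ∪ G keeps leaves and exchange and forces the step B into F ∪
    -- G, so that it is strictly closer to the other end.
    let T := S.filter (· ⊆ F ∪ G)
    have hTS : T ⊆ S := Finset.filter_subset _ _
    have hTE : HasExchange T := by
      intro X hX Y hY hXY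
      obtain ⟨C, hC, hsub, hcard⟩ := hE X (hTS hX) Y (hTS hY) hXY
      exact ⟨C, Finset.mem_filter.2 ⟨hC, hsub.trans (Finset.union_subset
        (Finset.mem_filter.1 hX).2 (Finset.mem_filter.1 hY).2)⟩, hsub, hcard⟩
    obtain ⟨B, hB, hsub, hstep⟩ := HasLeaves.exists_step_of_hasExchange (q := q) _ rfl
      (hL.mono hTS) (fun A hA => hq A (hTS hA)) hTE
      (Finset.mem_filter.2 ⟨hF, Finset.subset_union_left⟩ : F ∈ T)
      (Finset.mem_filter.2 ⟨hG, Finset.subset_union_right⟩ : G ∈ T) hFG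
    have hBS := hTS hB
    have hBsub : B ⊆ F ∪ G := (Finset.mem_filter.1 hB).2
    rcases hstep with h | h
    · have hlt := card_sdiff_lt_of_step (by rw [hq _ hBS, hq _ hF])
        (by rintro rfl; simp at h) hsub hBsub
      obtain ⟨C, hCS, hhead, hlast, hchain, hlen⟩ := ih _ (hn ▸ hlt) hBS hG rfl
      refine ⟨F :: C, by simpa [hF] using hCS, rfl, ?_, ?_, ?_⟩
      · rw [List.getLast?_cons, hlast]
        rfl
      · rw [List.isChain_cons]
        refine ⟨fun D hD => ?_, hchain⟩
        rw [hhead] at hD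
        obtain rfl : B = D := by simpa using hD
        exact h
      · simp only [List.length_cons]
        omega
    · have hlt := card_sdiff_lt_of_step (F := G) (G := F) (by rw [hq _ hBS, hq _ hG])
        (by rintro rfl; simp at h) (by rwa [Finset.inter_comm]) (by rwa [Finset.union_comm])
      rw [card_sdiff_comm_of_card_eq (A := B) (by rw [hq _ hBS, hq _ hF]),
        card_sdiff_comm_of_card_eq (A := G) (by rw [hq _ hG, hq _ hF]), hn] at hlt
      obtain ⟨C, hCS, hhead, hlast, hchain, hlen⟩ := ih _ hlt hF hBS rfl
      refine ⟨C ++ [G], ?_, ?_, ?_, ?_, ?_⟩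
      · intro H hH
        rcases List.mem_append.1 hH with hH | hH
        · exact hCS H hH
        · rw [List.mem_singleton.1 hH]
          exact hG
      · simp [hhead]
      · simp
      · rw [List.isChain_append]
        refine ⟨hchain, List.isChain_singleton _, ?_⟩
        intro x hx y hy
        rw [hlast] at hx
        obtain rfl : B = x := by simpa using hx
        obtain rfl : G = y := by simpa using hy
        rwa [card_sdiff_comm_of_card_eq (by rw [hq _ hBS, hq _ hG])] at h
      · simp only [List.length_append, List.length_singleton]
        omega

/-- A sequence of steps exchanging single vertices is at least as long as the difference of its
end points. -/
lemma card_sdiff_lt_length {C : List (Finset V)} : ∀ {F G : Finset V}, C.head? = some F →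
    C.getLast? = some G → C.IsChain (fun A B => (B \ A).card = 1) →
    (G \ F).card + 1 ≤ C.length := by
  induction C with
  | nil => simp
  | cons A C ih =>
    intro F G hF hG hC
    obtain rfl : A = F := by simpa using hF
    cases C with
    | nil =>
      obtain rfl : A = G := by simpa using hG
      simp
    | cons B C =>
      rw [List.isChain_cons_cons] at hC
      have h := ih rfl (by simpa using hG) hC.2
      have h2 : G \ A ⊆ (G \ B) ∪ (B \ A) := by
        intro v hv
        simp only [Finset.mem_union, Finset.mem_sdiff] at hv ⊢
        tauto
      have h3 := (Finset.card_le_card h2).trans (Finset.card_union_le _ _)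
      simp only [List.length_cons] at h ⊢
      omega

/-- Leaves are removed one at a time and listed backwards. Every initial segment retains exchange,
so the set exchanged with `g i` comes earlier. -/
lemma exists_leaf_order {q : ℕ} (n : ℕ) : ∀ {S : Finset (Finset V)}, S.card = n →
    HasLeaves S → (∀ A ∈ S, A.card = q) → HasExchange S →
    ∃ g : Fin n → Finset V, (∀ A, A ∈ S ↔ ∃ i, g i = A) ∧
      ∀ i j, j < i → ∃ k < i, g k ⊆ g i ∪ g j ∧ (g k \ g i).card = 1 := by
  induction n with
  | zero =>
    intro S hn _ _ _
    rw [Finset.card_eq_zero] at hn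
    exact ⟨Fin.elim0, by simp [hn], fun i => i.elim0⟩
  | succ n ih =>
    intro S hn hL hq hE
    obtain ⟨A, hA, hleaf⟩ := hL S subset_rfl (Finset.card_pos.1 (by omega))
    obtain ⟨g, hg, hex⟩ := ih (S := S.erase A) (by rw [Finset.card_erase_of_mem hA, hn]; rfl)
        (hL.mono (Finset.erase_subset _ _)) (fun X hX => hq X (Finset.mem_of_mem_erase hX))
        (hE.erase_leaf hq hA hleaf)
    refine ⟨Fin.snoc (α := fun _ => Finset V) g A, fun B => ?_, fun i j hji => ?_⟩
    · rw [Fin.exists_fin_succ']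
      simp only [Fin.snoc_castSucc, Fin.snoc_last, ← hg, Finset.mem_erase]
      constructor
      · intro hB
        by_cases h : B = A
        · exact Or.inr h.symm
        · exact Or.inl ⟨h, hB⟩
      · rintro (h | rfl)
        · exact h.2
        · exact hA
    · induction i using Fin.lastCases with
      | last =>
        obtain ⟨j, rfl⟩ := Fin.exists_castSucc_eq.2 hji.ne
        have hj := Finset.mem_erase.1 ((hg (g j)).2 ⟨j, rfl⟩)
        obtain ⟨C, hC, hsub, hcard⟩ := hE A hA (g j) hj.2 (Ne.symm hj.1)
        obtain ⟨k, rfl⟩ := (hg C).1 (Finset.mem_erase.2 ⟨by rintro rfl; simp at hcard, hC⟩)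
        exact ⟨k.castSucc, Fin.castSucc_lt_last k, by simpa using hsub, by simpa using hcard⟩
      | cast i =>
        have hjl : j ≠ Fin.last n := (hji.trans (Fin.castSucc_lt_last i)).ne
        obtain ⟨j, rfl⟩ := Fin.exists_castSucc_eq.2 hjl
        obtain ⟨k, hk, h1, h2⟩ := hex i j (Fin.castSucc_lt_castSucc_iff.1 hji)
        exact ⟨k.castSucc, Fin.castSucc_lt_castSucc_iff.2 hk, by simpa using h1,
          by simpa using h2⟩

end FacetFamilies

/-! ### Squarefree monomial ideals and their linear syzygies -/

section SquarefreeMonomials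

open MvPolynomial

variable {V K : Type*} [Field K]

/-- The exponent vector of the squarefree monomial with support `F`. -/
noncomputable def squarefreeExp (F : Finset V) : V →₀ ℕ :=
  ∑ v ∈ F, Finsupp.single v 1

lemma prod_X_eq_monomial (F : Finset V) :
    (∏ v ∈ F, X v : MvPolynomial V K) = monomial (squarefreeExp F) 1 := by
  rw [squarefreeExp, monomial_sum_one]
  rfl

lemma degree_squarefreeExp (F : Finset V) : (squarefreeExp F).degree = F.card := by
  simp [squarefreeExp]

lemma exists_squarefreeExp_le {P : Set (Finset V)} {f : MvPolynomial V K}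
    (hf : f ∈ Ideal.span {f | ∃ F, F ∈ P ∧ f = ∏ v ∈ F, X v}) {m : V →₀ ℕ}
    (hm : coeff m f ≠ 0) : ∃ F ∈ P, squarefreeExp F ≤ m := by
  have : {f : MvPolynomial V K | ∃ F, F ∈ P ∧ f = ∏ v ∈ F, X v} =
      (fun s => monomial s (1 : K)) '' (squarefreeExp '' P) := by
    ext f
    simp only [Set.mem_ofPred_eq, Set.mem_image, exists_exists_and_eq_and, prod_X_eq_monomial]
    simp only [eq_comm]
  rw [this, mem_ideal_span_monomial_image] at hf
  obtain ⟨_, ⟨F, hF, rfl⟩, h⟩ := hf m (mem_support_iff.2 hm)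
  exact ⟨F, hF, h⟩

lemma eq_of_le_of_degree_le {m n : V →₀ ℕ} (h : m ≤ n) (hd : n.degree ≤ m.degree) : m = n := by
  obtain ⟨r, rfl⟩ := exists_add_of_le h
  rw [map_add] at hd
  have : r = 0 := (Finsupp.degree_eq_zero_iff r).1 (by omega)
  simp [this]

lemma exists_single_of_degree_eq_one {m : V →₀ ℕ} (h : m.degree = 1) :
    ∃ v, Finsupp.single v 1 = m := by
  have : m ∈ {d : V →₀ ℕ | d.degree = 1} := h
  rwa [← Finsupp.range_single_one] at this

lemma linearMap_apply_eq_sum {R M : Type*} [CommRing R] [AddCommGroup M] [Module R M] {n : ℕ}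
    (f : (Fin n → R) →ₗ[R] M) (c : Fin n → R) : f c = ∑ j, c j • f (Pi.single j 1) := by
  rw [LinearMap.pi_apply_eq_sum_univ f c]
  refine Finset.sum_congr rfl fun j _ => ?_
  congr 2
  funext l
  simp [Pi.single_apply, eq_comm]

variable [DecidableEq V]

lemma squarefreeExp_apply (F : Finset V) (v : V) :
    squarefreeExp F v = if v ∈ F then 1 else 0 := by
  simp [squarefreeExp, Finsupp.finsetSum_apply, Finsupp.single_apply]

lemma squarefreeExp_le_iff {F G : Finset V} : squarefreeExp F ≤ squarefreeExp G ↔ F ⊆ G := by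
  simp only [Finsupp.le_def, squarefreeExp_apply]
  refine forall_congr' fun v => ?_
  by_cases h1 : v ∈ F <;> by_cases h2 : v ∈ G <;> simp [h1, h2]

/-- A uniform family of vertex sets, ordered so that every earlier set can be approached from a
later one by exchanging one vertex within the initial segment, gives monomials with linear
quotients. -/
theorem hasLinearQuotients_of_exchange {n q : ℕ} {g : Fin n → Finset V}
    (hq : ∀ i, (g i).card = q)
    (hg : ∀ i j, j < i → ∃ k < i, g k ⊆ g i ∪ g j ∧ (g k \ g i).card = 1) :
    HasLinearQuotients (V := V) (K := K) (fun i => (∏ v ∈ g i, X v : MvPolynomial V K)) := by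
  classical
  intro i
  -- The vertices by which some earlier set differs from `g i`: the variables of the colon ideal.
  let A : Finset V := (Finset.univ.biUnion g).filter (fun v => ∃ k < i, g k \ g i = {v})
  have hA : ∀ v, v ∈ A ↔ ∃ k < i, g k \ g i = {v} := by
    intro v
    simp only [A, Finset.mem_filter, Finset.mem_biUnion, Finset.mem_univ, true_and,
      and_iff_right_iff_imp]
    rintro ⟨k, -, hk⟩
    exact ⟨k, Finset.sdiff_subset (hk ▸ Finset.mem_singleton_self v)⟩
  have hrange : Set.range (fun t => (A.equivFin.symm t : V)) = A := by
    ext v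
    constructor
    · rintro ⟨t, rfl⟩
      exact (A.equivFin.symm t).2
    · intro hv
      exact ⟨A.equivFin ⟨v, hv⟩, by simp⟩
  refine ⟨A.card, fun t => (A.equivFin.symm t : V),
    Subtype.val_injective.comp A.equivFin.symm.injective, fun t => ?_, fun r c hc hr => ?_⟩
  · obtain ⟨k, hki, hk⟩ := (hA _).1 (A.equivFin.symm t).2
    set v : V := (A.equivFin.symm t : V)
    obtain ⟨w, hw⟩ : ∃ w, g i \ g k = {w} := by
      rw [← Finset.card_eq_one, card_sdiff_comm_of_card_eq (by rw [hq, hq]), hk,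
        Finset.card_singleton]
    refine ⟨Pi.single k (X w), fun j => ?_, fun j hj => ?_, ?_⟩
    · by_cases h : j = k
      · subst h
        simpa using isHomogeneous_X K w
      · rw [Pi.single_eq_of_ne h]
        exact isHomogeneous_zero _ _ _
    · exact Pi.single_eq_of_ne (hki.trans_le hj).ne' _
    · rw [Finset.sum_eq_single k]
      · have hv : v ∉ g i := by
          have : v ∈ g k \ g i := hk ▸ Finset.mem_singleton_self v
          exact (Finset.mem_sdiff.1 this).2
        have hw' : w ∉ g k := by
          have : w ∈ g i \ g k := hw ▸ Finset.mem_singleton_self w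
          exact (Finset.mem_sdiff.1 this).2
        rw [Pi.single_eq_same, smul_eq_mul, smul_eq_mul, ← Finset.prod_insert hv,
          ← Finset.prod_insert hw']
        congr 1
        ext x
        have h1 := Finset.ext_iff.1 hk x
        have h2 := Finset.ext_iff.1 hw x
        simp only [Finset.mem_sdiff, Finset.mem_singleton, Finset.mem_insert] at h1 h2 ⊢
        tauto
      · intro j _ hj
        rw [Pi.single_eq_of_ne hj, zero_smul]
      · simp
  · rw [hrange, mem_ideal_span_X_image]
    intro m hm
    have hmem : r * ∏ v ∈ g i, X v ∈
        Ideal.span {f : MvPolynomial V K | ∃ F, F ∈ g '' {j | j < i} ∧ f = ∏ v ∈ F, X v} := by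
      rw [smul_eq_mul] at hr
      rw [hr]
      refine Ideal.sum_mem _ fun j _ => ?_
      by_cases hj : j < i
      · exact Ideal.mul_mem_left _ _ (Ideal.subset_span ⟨g j, ⟨j, hj, rfl⟩, rfl⟩)
      · rw [hc j (not_lt.1 hj), zero_smul]
        exact Ideal.zero_mem _
    -- Some earlier x^(g j) divides x^m · x^(g i), so m involves every vertex of g j \ g i, among
    -- them the vertex exchanged towards g j.
    obtain ⟨_, ⟨j, hj, rfl⟩, hle⟩ := exists_squarefreeExp_le (m := m + squarefreeExp (g i)) hmem
      (by
        rw [prod_X_eq_monomial, coeff_mul_monomial, mul_one]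
        exact mem_support_iff.1 hm)
    obtain ⟨k, hki, hsub, hcard⟩ := hg i j hj
    obtain ⟨v, hv⟩ := Finset.card_eq_one.1 hcard
    refine ⟨v, (hA v).2 ⟨k, hki, hv⟩, ?_⟩
    have hv' : v ∈ g k \ g i := hv ▸ Finset.mem_singleton_self v
    rw [Finset.mem_sdiff] at hv'
    have hvj : v ∈ g j := (Finset.mem_union.1 (hsub hv'.1)).resolve_left hv'.2
    have := hle v
    simp only [Finsupp.add_apply, squarefreeExp_apply, hvj, hv'.2, if_true, if_false] at this
    omega

/-- If forms of degree `q` generate the ideal of the squarefree monomials of an antichain `P`, then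
all members of `P` have `q` elements. -/
lemma card_eq_of_span_eq {P : Set (Finset V)} (hP : ∀ F ∈ P, ∀ G ∈ P, F ⊆ G → F = G)
    {q b : ℕ} {f : Fin b → MvPolynomial V K} (hf : ∀ j, (f j).IsHomogeneous q)
    (hspan : Ideal.span (Set.range f) = Ideal.span {f | ∃ F, F ∈ P ∧ f = ∏ v ∈ F, X v}) :
    ∀ F ∈ P, F.card = q := by
  intro F hF
  have hmem : (∏ v ∈ F, X v : MvPolynomial V K) ∈ Ideal.span (Set.range f) :=
    hspan ▸ Ideal.subset_span ⟨F, hF, rfl⟩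
  rw [Ideal.mem_span_range_iff_exists_fun] at hmem
  obtain ⟨c, hc⟩ := hmem
  have hne : coeff (squarefreeExp F) (∑ j, c j * f j) ≠ 0 := by
    rw [hc, prod_X_eq_monomial, coeff_monomial, if_pos rfl]
    exact one_ne_zero
  rw [coeff_sum] at hne
  -- Some f j has a monomial of degree q dividing x^F. It is a multiple of some x^G, and the
  -- antichain condition gives G = F.
  obtain ⟨j, -, hj⟩ := Finset.exists_ne_zero_of_sum_ne_zero hne
  rw [coeff_mul] at hj
  obtain ⟨x, hx, hxne⟩ := Finset.exists_ne_zero_of_sum_ne_zero hj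
  have hx2 := right_ne_zero_of_mul hxne
  have hdeg : x.2.degree = q := by
    by_contra h
    exact hx2 ((hf j).coeff_eq_zero h)
  have hle : x.2 ≤ squarefreeExp F :=
    (Finset.HasAntidiagonal.mem_antidiagonal.1 hx) ▸ le_add_self
  obtain ⟨G, hG, hGle⟩ := exists_squarefreeExp_le
    (hspan ▸ Ideal.subset_span ⟨j, rfl⟩ :
      f j ∈ Ideal.span {f | ∃ F, F ∈ P ∧ f = ∏ v ∈ F, X v}) hx2
  have hGF := hP G hG F hF (squarefreeExp_le_iff.1 (hGle.trans hle))
  subst hGF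
  rw [← degree_squarefreeExp, ← hdeg, le_antisymm hle hGle]

/-- A linear syzygy of forms supported on the squarefree monomials of `P`, contracted at a member
`F` of `P` without neighbours in `F ∪ G`, does not involve the vertices of `G \ F`. -/
lemma coeff_single_linear_syzygy {P : Set (Finset V)} {b : ℕ} {f s : Fin b → MvPolynomial V K}
    (hf : ∀ j m, coeff m (f j) ≠ 0 → ∃ A ∈ P, m = squarefreeExp A)
    (hs : ∀ j, (s j).IsHomogeneous 1) (h0 : ∑ j, s j * f j = 0) {F G : Finset V}
    (hno : ∀ A ∈ P, A ⊆ F ∪ G → (A \ F).card ≠ 1) {v : V} (hv : v ∈ G \ F) :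
    coeff (Finsupp.single v 1) (∑ j, C (coeff (squarefreeExp F) (f j)) * s j) = 0 := by
  rw [Finset.mem_sdiff] at hv
  have h1 : coeff (Finsupp.single v 1 + squarefreeExp F) (∑ j, s j * f j) = 0 := by
    rw [h0, coeff_zero]
  rw [coeff_sum] at h1
  rw [coeff_sum, ← h1]
  refine Finset.sum_congr rfl fun j _ => ?_
  rw [coeff_C_mul, mul_comm, coeff_mul, Finset.sum_eq_single (Finsupp.single v 1, squarefreeExp F)]
  -- Any other factorization x_w · x^A of x_v · x^F has w ≠ v, which makes A a forbidden neighbour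
  -- with A \ F = {v}.
  · rintro ⟨α, β⟩ hx hne
    rw [Finset.HasAntidiagonal.mem_antidiagonal] at hx
    by_contra hprod
    have hα := left_ne_zero_of_mul hprod
    obtain ⟨A, hA, hβ⟩ := hf j β (right_ne_zero_of_mul hprod)
    have hαdeg : α.degree = 1 := by
      by_contra h
      exact hα ((hs j).coeff_eq_zero h)
    obtain ⟨w, rfl⟩ := exists_single_of_degree_eq_one hαdeg
    dsimp only at hβ hx
    subst hβ
    have hwv : w ≠ v := by
      rintro rfl
      exact hne (by rw [add_left_cancel hx])
    have hmem : ∀ x, x ∈ A → x = v ∨ x ∈ F := by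
      intro x hxA
      have := DFunLike.congr_fun hx x
      by_contra! hcon
      simp [squarefreeExp_apply, hxA, hcon.2, Finsupp.single_apply, Ne.symm hcon.1] at this
    have hvA : v ∈ A := by
      have := DFunLike.congr_fun hx v
      by_contra hcon
      simp [squarefreeExp_apply, hcon, hv.2, hwv] at this
    refine hno A hA (fun x hxA => ?_) ?_
    · rcases hmem x hxA with rfl | h
      · exact Finset.mem_union_right _ hv.1
      · exact Finset.mem_union_left _ h
    · rw [Finset.card_eq_one]
      refine ⟨v, ?_⟩
      ext x
      simp only [Finset.mem_sdiff, Finset.mem_singleton]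
      constructor
      · rintro ⟨h1, h2⟩
        exact (hmem x h1).resolve_right h2
      · rintro rfl
        exact ⟨hvA, hv.2⟩
  · intro hx
    rw [Finset.HasAntidiagonal.mem_antidiagonal] at hx
    exact absurd rfl hx

/-- A variable dividing x^D belongs to D, and no such variable occurs in p. -/
lemma coeff_mul_linear_eq_zero {D : Finset V} {p : MvPolynomial V K} (hp : p.IsHomogeneous 1)
    (h : ∀ v ∈ D, coeff (Finsupp.single v 1) p = 0) (r : MvPolynomial V K) :
    coeff (squarefreeExp D) (r * p) = 0 := by
  rw [coeff_mul]
  refine Finset.sum_eq_zero fun x hx => ?_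
  rw [Finset.HasAntidiagonal.mem_antidiagonal] at hx
  by_contra hprod
  have hβ := right_ne_zero_of_mul hprod
  have hdeg : x.2.degree = 1 := by
    by_contra h
    exact hβ (hp.coeff_eq_zero h)
  obtain ⟨v, hv⟩ := exists_single_of_degree_eq_one hdeg
  rw [← hv] at hβ hx
  refine hβ (h v ?_)
  have := DFunLike.congr_fun hx v
  by_contra hcon
  simp [squarefreeExp_apply, hcon] at this

/-- If the squarefree monomials of an antichain `P` generate an ideal with a linear resolution,
then `P` is uniform and has the exchange property. -/
theorem exchange_of_hasLinearResolution {P : Set (Finset V)}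
    (hP : ∀ F ∈ P, ∀ G ∈ P, F ⊆ G → F = G)
    (h : HasLinearResolution
      (Ideal.span {f : MvPolynomial V K | ∃ F, F ∈ P ∧ f = ∏ v ∈ F, X v})) :
    ∃ q, (∀ F ∈ P, F.card = q) ∧
      ∀ F ∈ P, ∀ G ∈ P, F ≠ G → ∃ C ∈ P, C ⊆ F ∪ G ∧ (C \ F).card = 1 := by
  obtain ⟨q, b, ε, δ, hrange, hex, -, hε, hδ⟩ := h
  set f : Fin (b 0) → MvPolynomial V K := fun j => ε (Pi.single j 1) with hfdef
  have hεf : ∀ c, ε c = ∑ j, c j * f j := fun c => linearMap_apply_eq_sum ε c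
  have hfI : ∀ j, f j ∈ Ideal.span {f : MvPolynomial V K | ∃ F, F ∈ P ∧ f = ∏ v ∈ F, X v} :=
    fun j => hrange ▸ LinearMap.mem_range_self ε _
  have hcard : ∀ F ∈ P, F.card = q := by
    refine card_eq_of_span_eq hP hε ?_
    rw [← hrange]
    ext p
    rw [Ideal.mem_span_range_iff_exists_fun, LinearMap.mem_range]
    exact exists_congr fun c => by rw [hεf]
  refine ⟨q, hcard, fun F hF G hG hFG => ?_⟩
  by_contra! hno
  have hfsupp : ∀ j m, coeff m (f j) ≠ 0 → ∃ A ∈ P, m = squarefreeExp A := by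
    intro j m hm
    obtain ⟨A, hA, hle⟩ := exists_squarefreeExp_le (hfI j) hm
    have hdeg : m.degree = q := by
      by_contra h
      exact hm ((hε j).coeff_eq_zero h)
    exact ⟨A, hA, (eq_of_le_of_degree_le hle
      (by rw [hdeg, degree_squarefreeExp, hcard A hA])).symm⟩
  -- Contraction at F: each basis vector goes to the coefficient of x^F in its generator.
  let ψ : (Fin (b 0) → MvPolynomial V K) →ₗ[MvPolynomial V K] MvPolynomial V K :=
    Fintype.linearCombination _ (fun j => C (coeff (squarefreeExp F) (f j)))
  have hψ : ∀ c, ψ c = ∑ j, C (coeff (squarefreeExp F) (f j)) * c j := fun c =>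
    (Fintype.linearCombination_apply _ _ _).trans (Finset.sum_congr rfl fun _ _ => mul_comm _ _)
  have hψδ : ∀ l, ∀ v ∈ G \ F,
      coeff (Finsupp.single v 1) (ψ (δ 0 (Pi.single l 1))) = 0 := by
    intro l v hv
    rw [hψ]
    refine coeff_single_linear_syzygy hfsupp (hδ 0 l) ?_ hno hv
    rw [← hεf, hex.apply_apply_eq_zero]
  have hψrange : ∀ d, coeff (squarefreeExp (G \ F)) (ψ (δ 0 d)) = 0 := by
    intro d
    rw [linearMap_apply_eq_sum (δ 0) d, map_sum, coeff_sum]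
    refine Finset.sum_eq_zero fun l _ => ?_
    rw [map_smul, smul_eq_mul]
    refine coeff_mul_linear_eq_zero ?_ (hψδ l) _
    rw [hψ]
    exact IsHomogeneous.sum _ _ _ fun j _ => (hδ 0 l j).C_mul _
  obtain ⟨u, hu⟩ : (∏ v ∈ F, X v : MvPolynomial V K) ∈ LinearMap.range ε :=
    hrange ▸ Ideal.subset_span ⟨F, hF, rfl⟩
  obtain ⟨w, hw⟩ : (∏ v ∈ G, X v : MvPolynomial V K) ∈ LinearMap.range ε :=
    hrange ▸ Ideal.subset_span ⟨G, hG, rfl⟩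
  have hrel : ε ((∏ v ∈ G \ F, X v : MvPolynomial V K) • u -
      (∏ v ∈ F \ G, X v : MvPolynomial V K) • w) = 0 := by
    rw [map_sub, map_smul, map_smul, hu, hw, smul_eq_mul, smul_eq_mul,
      ← Finset.prod_union Finset.sdiff_disjoint, ← Finset.prod_union Finset.sdiff_disjoint,
      Finset.sdiff_union_self_eq_union, Finset.sdiff_union_self_eq_union, Finset.union_comm,
      sub_self]
  obtain ⟨d, hd⟩ := (hex _).1 hrel
  have hzero := hψrange d
  have hnle : ¬ squarefreeExp (F \ G) ≤ squarefreeExp (G \ F) := by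
    rw [squarefreeExp_le_iff]
    intro hsub
    refine hFG (hP F hF G hG fun v hv => ?_)
    by_contra hvG
    exact (Finset.mem_sdiff.1 (hsub (Finset.mem_sdiff.2 ⟨hv, hvG⟩))).2 hv
  -- In degree q only the constant terms of the u j contribute to the coefficient of x^F in ε u.
  have hone : coeff 0 (ψ u) = 1 := by
    have h1 : coeff (squarefreeExp F) (ε u) = 1 := by
      rw [hu, prod_X_eq_monomial, coeff_monomial, if_pos rfl]
    rw [← h1, hεf, hψ, coeff_sum, coeff_sum]
    refine Finset.sum_congr rfl fun j _ => ?_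
    have h2 := congrArg (coeff (squarefreeExp F))
      (homogeneousComponent_mul_of_isHomogeneous 0 q (u j) (f j) (hε j))
    rw [coeff_homogeneousComponent, if_pos (by rw [degree_squarefreeExp, hcard F hF, zero_add]),
      homogeneousComponent_zero, coeff_C_mul] at h2
    rw [coeff_C_mul, h2, mul_comm]
  -- The coefficient of x^(G \ F) in the contracted relation is 1 - 0, whereas it vanishes on
  -- contracted syzygies.
  rw [hd, map_sub, map_smul, map_smul, smul_eq_mul, smul_eq_mul, prod_X_eq_monomial,
    prod_X_eq_monomial, coeff_sub, coeff_monomial_mul', coeff_monomial_mul', if_pos le_rfl,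
    if_neg hnle, tsub_self, hone] at hzero
  simp at hzero

end SquarefreeMonomials

/-! ### Exchange and the intersection property for trees -/

section Trees

variable {V : Type*}

lemma IsFacet.eq_of_subset {Δ : PreAbstractSimplicialComplex V} {F G : Finset V}
    (hF : IsFacet Δ F) (hG : IsFacet Δ G) (h : F ⊆ G) : F = G :=
  hF.eq_of_le hG.1 h

/-- The complex whose facets are the maximal members of `T`. -/
def generatedComplex (T : Set (Finset V)) : PreAbstractSimplicialComplex V where
  faces := {s | s.Nonempty ∧ ∃ F ∈ T, s ⊆ F}
  isRelLowerSet_faces := fun _ ⟨hs, F, hF, hsF⟩ =>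
    ⟨hs, fun _ hts ht => ⟨ht, F, hF, Finset.Subset.trans hts hsF⟩⟩

lemma isFace_generatedComplex {T : Set (Finset V)} (hT : T.Nonempty) {s : Finset V} :
    IsFace (generatedComplex T) s ↔ ∃ F ∈ T, s ⊆ F := by
  constructor
  · rintro (rfl | h)
    · obtain ⟨F, hF⟩ := hT
      exact ⟨F, hF, Finset.empty_subset F⟩
    · exact h.2
  · intro h
    rcases s.eq_empty_or_nonempty with rfl | hs
    · exact Or.inl rfl
    · exact Or.inr ⟨hs, h⟩

lemma isFacet_generatedComplex {T : Set (Finset V)} (hT : T.Nonempty)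
    (hanti : ∀ F ∈ T, ∀ G ∈ T, F ⊆ G → F = G) {s : Finset V} :
    IsFacet (generatedComplex T) s ↔ s ∈ T := by
  constructor
  · intro h
    obtain ⟨F, hF, hsF⟩ := (isFace_generatedComplex hT).1 h.1
    rwa [h.eq_of_le ((isFace_generatedComplex hT).2 ⟨F, hF, Finset.Subset.refl F⟩) hsF]
  · intro h
    refine ⟨(isFace_generatedComplex hT).2 ⟨s, h, Finset.Subset.refl s⟩, fun t ht hst => ?_⟩
    obtain ⟨F, hF, htF⟩ := (isFace_generatedComplex hT).1 ht
    rw [hanti s h F hF (Finset.Subset.trans hst htF)]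
    exact htF

variable [DecidableEq V]

/-- Facets form an antichain, so a set of facets is exactly the facet set of the complex it
generates. -/
lemma IsTree.hasLeaves {Δ : PreAbstractSimplicialComplex V} (hΔ : IsTree Δ)
    {S : Finset (Finset V)} (hS : ∀ F ∈ S, IsFacet Δ F) : HasLeaves S := by
  intro T hTS hT
  have hfacet : ∀ s, IsFacet (generatedComplex (T : Set (Finset V))) s ↔ s ∈ T := fun s =>
    isFacet_generatedComplex hT fun F hF G hG h =>
      (hS F (hTS hF)).eq_of_subset (hS G (hTS hG)) h
  obtain ⟨A, hA, hleaf⟩ := hΔ.2 (generatedComplex T) fun F hF => hS F (hTS ((hfacet F).1 hF))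
  simp only [hfacet] at hA hleaf
  exact ⟨A, hA, hleaf⟩

lemma faceDim_inter_eq_iff {A B : Finset V} :
    faceDim (A ∩ B) = faceDim B - 1 ↔ (B \ A).card = 1 := by
  have h := Finset.card_sdiff_add_card_inter B A
  rw [Finset.inter_comm] at h
  unfold faceDim
  omega

lemma IsProperChain.isChain_sdiff {Δ : PreAbstractSimplicialComplex V} {F G : Finset V}
    {C : List (Finset V)} (h : IsProperChain Δ F G C) :
    C.IsChain (fun A B => (B \ A).card = 1) :=
  h.2.imp fun _ _ => faceDim_inter_eq_iff.1

/-- Sets with at most one element that meet are equal. This handles facets that are single vertices,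
which differ in one vertex without meeting. -/
lemma eq_of_chain_of_card_le_one {C : List (Finset V)} : ∀ {F G : Finset V},
    (∀ H ∈ C, H.card ≤ 1) → C.head? = some F → C.getLast? = some G →
    C.IsChain (fun A B => (A ∩ B).Nonempty) → F = G := by
  induction C with
  | nil => simp
  | cons A C ih =>
    intro F G hcard hF hG hC
    obtain rfl : A = F := by simpa using hF
    cases C with
    | nil => simpa using hG
    | cons B C =>
      rw [List.isChain_cons_cons] at hC
      have hBG : B = G :=
        ih (fun H hH => hcard H (List.mem_cons_of_mem _ hH)) rfl (by simpa using hG) hC.2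
      have h1 := Finset.card_pos.2 hC.1
      have hA := hcard A (by simp)
      have hB := hcard B (by simp)
      have hl : A ∩ B = A := Finset.eq_of_subset_of_card_le Finset.inter_subset_left (by omega)
      have hr : A ∩ B = B := Finset.eq_of_subset_of_card_le Finset.inter_subset_right (by omega)
      exact (hl.symm.trans hr).trans hBG

/-- In a pure connected complex, facets which differ in a single vertex meet. -/
lemma IsConnectedComplex.inter_nonempty {Δ : PreAbstractSimplicialComplex V}
    (hΔ : IsConnectedComplex Δ) {q : ℕ} (hq : ∀ F, IsFacet Δ F → F.card = q) {A B : Finset V}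
    (hA : IsFacet Δ A) (hB : IsFacet Δ B) (h : (B \ A).card = 1) : (A ∩ B).Nonempty := by
  by_contra hne
  rw [Finset.not_nonempty_iff_eq_empty, ← Finset.disjoint_iff_inter_eq_empty] at hne
  rw [Finset.sdiff_eq_self_of_disjoint hne.symm, hq B hB] at h
  obtain ⟨C, hC, hhead, hlast, hchain⟩ := hΔ A B hA hB
  have := eq_of_chain_of_card_le_one (fun H hH => (hq H (hC H hH)).trans_le h.le)
    hhead hlast hchain
  subst this
  rw [disjoint_self] at hne
  have h1 := hq A hA
  rw [hne, h] at h1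
  simp at h1

/-- A tree which is pure with the exchange property has the intersection property. -/
theorem IsTree.hasIntersectionProperty_of_hasExchange
    {Δ : PreAbstractSimplicialComplex V} (hΔ : IsTree Δ) {S : Finset (Finset V)}
    (hS : ∀ F, F ∈ S ↔ IsFacet Δ F) {q : ℕ} (hq : ∀ F ∈ S, F.card = q) (hE : HasExchange S) :
    HasIntersectionProperty Δ := by
  have hq' : ∀ F, IsFacet Δ F → F.card = q := fun F hF => hq F ((hS F).2 hF)
  have hgal : ∀ F G, IsFacet Δ F → IsFacet Δ G →
      ∃ C, IsProperChain Δ F G C ∧ C.length = (G \ F).card + 1 := by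
    intro F G hF hG
    obtain ⟨C, hCS, hhead, hlast, hchain, hlen⟩ := exists_gallery (hΔ.hasLeaves fun F => (hS F).1)
      hq hE _ ((hS F).2 hF) ((hS G).2 hG) rfl
    have hCf : ∀ H ∈ C, IsFacet Δ H := fun H hH => (hS H).1 (hCS H hH)
    refine ⟨C, ⟨⟨hCf, hhead, hlast, ?_⟩, hchain.imp fun _ _ => faceDim_inter_eq_iff.2⟩, ?_⟩
    · exact List.IsChain.imp_of_mem_imp (fun A B hA hB h =>
        hΔ.1.inter_nonempty hq' (hCf A hA) (hCf B hB) h) hchain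
    · have := card_sdiff_lt_length hhead hlast hchain
      rw [card_sdiff_comm_of_card_eq (by rw [hq' F hF, hq' G hG])] at hlen
      omega
  have hdist : ∀ F G, IsFacet Δ F → IsFacet Δ G → facetDist Δ F G = (G \ F).card := by
    intro F G hF hG
    have hlow : ∀ C, IsProperChain Δ F G C → (G \ F).card + 1 ≤ C.length := fun C hC =>
      card_sdiff_lt_length hC.1.2.1 hC.1.2.2.1 hC.isChain_sdiff
    obtain ⟨C, hC, hlen⟩ := hgal F G hF hG
    have hmem : (G \ F).card ∈
        {n : ℕ | ∃ C, IsIrredundantProperChain Δ F G C ∧ C.length = n + 1} :=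
      -- A proper chain of least possible length has no shorter proper subchain, hence is
      -- irredundant.
      ⟨C, ⟨hC, fun C' hsub hC' => hsub.eq_of_length_le (hlen ▸ hlow C' hC')⟩, hlen⟩
    refine le_antisymm (Nat.sInf_le hmem) (le_csInf ⟨_, hmem⟩ ?_)
    rintro n ⟨C', hC', hlen'⟩
    have := hlow C' hC'.1
    omega
  refine ⟨(q : ℤ) - 1, fun F hF => by rw [faceDim, hq' F hF],
    fun F G hF hG _ => (hgal F G hF hG).imp fun _ h => h.1, fun F G hF hG k _ _ hk => ?_⟩
  rw [hdist F G hF hG]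
  have h := Finset.card_sdiff_add_card_inter G F
  rw [Finset.inter_comm, hq' G hG] at h
  unfold faceDim at hk
  omega

/-- The facets of a complex with the intersection property have the exchange property. -/
theorem HasIntersectionProperty.hasExchange {Δ : PreAbstractSimplicialComplex V}
    (h : HasIntersectionProperty Δ) {S : Finset (Finset V)} (hS : ∀ F, F ∈ S ↔ IsFacet Δ F) :
    ∃ q, (∀ F ∈ S, F.card = q) ∧ HasExchange S := by
  obtain ⟨d, hpure, -, hdist⟩ := h
  have hcard : ∀ F, IsFacet Δ F → (F.card : ℤ) = d + 1 := fun F hF => by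
    have := hpure F hF
    unfold faceDim at this
    omega
  refine ⟨(d + 1).toNat, fun F hF => by have := hcard F ((hS F).1 hF); omega,
    fun A hA B hB hAB => ?_⟩
  rw [hS] at hA hB
  have hAc := hcard A hA
  have hBc := hcard B hB
  have hk := Finset.card_sdiff_add_card_inter B A
  have hpos : 1 ≤ (B \ A).card := by
    rw [Nat.one_le_iff_ne_zero, Ne, Finset.card_eq_zero, Finset.sdiff_eq_empty_iff_subset]
    exact fun hsub => hAB (hB.eq_of_subset hA hsub).symm
  have hAB' := hdist A B hA hB (B \ A).card hpos (by omega) (by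
    rw [faceDim, Finset.inter_comm]
    omega)
  -- The infimum of the empty set is 0, but the distance is |B \ A| ≥ 1.
  have hne : {n : ℕ | ∃ C, IsIrredundantProperChain Δ A B C ∧ C.length = n + 1}.Nonempty := by
    by_contra hemp
    rw [facetDist, Set.not_nonempty_iff_eq_empty.1 hemp, Nat.sInf_empty] at hAB'
    omega
  obtain ⟨C, ⟨hC, -⟩, hlen⟩ := Nat.sInf_mem hne
  rw [← facetDist, hAB'] at hlen
  have hchain := hC.isChain_sdiff
  obtain ⟨⟨hCf, hhead, hlast, -⟩, -⟩ := hC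
  match C, hlen, hchain, hCf, hhead, hlast with
  | [], hlen, _, _, _, _ => simp at hlen
  | [_], hlen, _, _, _, _ =>
    simp only [List.length_singleton] at hlen
    omega
  | A' :: D :: C, hlen, hchain, hCf, hhead, hlast =>
    obtain rfl : A' = A := by simpa using hhead
    rw [List.isChain_cons_cons] at hchain
    have hlow := card_sdiff_lt_length (C := D :: C) rfl (by simpa using hlast) hchain.2
    refine ⟨D, (hS D).2 (hCf D (by simp)), ?_, hchain.1⟩
    obtain ⟨v, hv⟩ := Finset.card_eq_one.1 hchain.1
    have hmem : ∀ x, x ∈ D → x ∉ A' → x = v := fun x h1 h2 =>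
      Finset.mem_singleton.1 (hv ▸ Finset.mem_sdiff.2 ⟨h1, h2⟩)
    -- The chain from D has one step fewer, so |B \ D| < |B \ A|; the vertex gained must lie in B.
    have hvB : v ∈ B := by
      by_contra hvB
      have hsub : B \ A' ⊆ B \ D := by
        intro x hx
        rw [Finset.mem_sdiff] at hx ⊢
        exact ⟨hx.1, fun hxD => hvB (hmem x hxD hx.2 ▸ hx.1)⟩
      have := Finset.card_le_card hsub
      simp only [List.length_cons] at hlen hlow
      omega
    intro x hx
    by_cases hxA : x ∈ A'
    · exact Finset.mem_union_left _ hxA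
    · exact Finset.mem_union_right _ (hmem x hx hxA ▸ hvB)

/-- The facet ideal of a tree whose facets are uniform with the exchange property has a linear
resolution. -/
theorem IsTree.hasLinearResolution_of_hasExchange (K : Type*) [Field K]
    {Δ : PreAbstractSimplicialComplex V} (hΔ : IsTree Δ) {S : Finset (Finset V)}
    (hS : ∀ F, F ∈ S ↔ IsFacet Δ F) {q : ℕ} (hq : ∀ F ∈ S, F.card = q) (hE : HasExchange S) :
    HasLinearResolution (facetIdeal K Δ) := by
  obtain ⟨g, hg, hex⟩ := exists_leaf_order _ rfl (hΔ.hasLeaves fun F => (hS F).1) hq hE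
  have hgq : ∀ i, (g i).card = q := fun i => hq _ ((hg _).2 ⟨i, rfl⟩)
  have hres := (hasLinearQuotients_of_exchange (K := K) hgq hex).hasLinearResolution (q := q)
    fun i => by
      rw [prod_X_eq_monomial]
      exact MvPolynomial.isHomogeneous_monomial _ (by rw [degree_squarefreeExp, hgq])
  rw [facetIdeal]
  convert hres using 2
  ext f
  simp only [← hS, hg, Set.mem_ofPred_eq, Set.mem_range]
  constructor
  · rintro ⟨_, ⟨i, rfl⟩, rfl⟩
    exact ⟨i, rfl⟩
  · rintro ⟨i, rfl⟩
    exact ⟨_, ⟨i, rfl⟩, rfl⟩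

end Trees

end SimplicialTree

theorem theorem3p14 {V : Type*} [Fintype V] [DecidableEq V] (K : Type*) [Field K]
    (Δ : AbstractSimplicialComplex V)
    (hΔ : SimplicialTree.IsTree Δ.toPreAbstractSimplicialComplex) :
    SimplicialTree.IsLinearTree K Δ.toPreAbstractSimplicialComplex ↔
      SimplicialTree.HasIntersectionProperty Δ.toPreAbstractSimplicialComplex := by
  classical
  let S : Finset (Finset V) :=
    Finset.univ.filter (SimplicialTree.IsFacet Δ.toPreAbstractSimplicialComplex)
  have hS : ∀ F, F ∈ S ↔ SimplicialTree.IsFacet Δ.toPreAbstractSimplicialComplex F := by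
    simp [S]
  constructor
  · rintro ⟨-, hlin⟩
    obtain ⟨q, hq, hE⟩ := SimplicialTree.exchange_of_hasLinearResolution (K := K)
      (P := {F | SimplicialTree.IsFacet Δ.toPreAbstractSimplicialComplex F})
      (fun F hF G hG h => SimplicialTree.IsFacet.eq_of_subset hF hG h) hlin
    refine hΔ.hasIntersectionProperty_of_hasExchange hS (fun F hF => hq F ((hS F).1 hF))
      fun A hA B hB hAB => ?_
    obtain ⟨C, hC, h⟩ := hE A ((hS A).1 hA) B ((hS B).1 hB) hAB
    exact ⟨C, (hS C).2 hC, h⟩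
  · intro h
    obtain ⟨q, hq, hE⟩ := h.hasExchange hS
    exact ⟨hΔ, hΔ.hasLinearResolution_of_hasExchange K hS hq hE⟩
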